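/- Let $A$ be a (complex, not necessarily unital) $C^*$-algebra and let $X$ be an essential Banach $A$-bimodule, i.e. the linear spans of $\{ax : a\in A,\,x\in X\}$ and of $\{xa : a\in A,\, x\in X\}$ are both dense in $X$. Equip $X^*$ with the dual bimodule structure $(af)(x)=f(xa)$, $(fa)(x)=f(ax)$. A linear map $D\colon A\to X^*$ is called hyperlocal if $aD(b)c=0$ whenever $a,b,c\in A$ satisfy $ab=bc=0$; a derivation if $D(ab)=aD(b)+D(a)b$ for all $a,b\in A$; and a right multiplier if $D(ab)=aD(b)$ for all $a,b\in A$. Let $D\colon A\to X^*$ be a bounded linear operator. Then $D$ is hyperlocal if and only if there are a derivation $\mathcal D\colon A\to X^*$ and a right multiplier $T\colon A\to X^*$ with $D=\mathcal D+T$; moreover, in that case $\mathcal D$ and $T$ can be chosen bounded. In particular, if $D$ is hyperlocal, then for every (two-sided) bounded approximate identity $(e_\alpha)$ in $A$, $D$ is a derivation if and only if $D(e_\alpha)\to 0$ in the weak* topology of $X^*$; consequently $D$ is a derivation if and only if $D(e_\alpha)\to0$ weak* for some bounded approximate identity $(e_\alpha)$ in $A$. -/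

import Mathlib

open Filter Topology

universe u v w

/-- A Banach bimodule structure over a (possibly non-unital) Banach algebra `A` on a normed space
`X`: commuting bounded bilinear left and right actions `a · x = left a x`, `x · a = right a x`. -/
structure BanachBimodule (A : Type u) (X : Type v)
    [NonUnitalNormedRing A] [NormedSpace ℂ A] [NormedAddCommGroup X] [NormedSpace ℂ X] where
  left : A →L[ℂ] X →L[ℂ] X
  right : A →L[ℂ] X →L[ℂ] X
  left_mul : ∀ (a b : A) (x : X), left (a * b) x = left a (left b x)
  right_mul : ∀ (a b : A) (x : X), right (a * b) x = right b (right a x)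
  left_right : ∀ (a b : A) (x : X), left a (right b x) = right b (left a x)

namespace BanachBimodule

variable {A : Type u} {X : Type v}
  [NonUnitalNormedRing A] [NormedSpace ℂ A] [NormedAddCommGroup X] [NormedSpace ℂ X]

/-- `X` is essential as a left and as a right module: the linear spans of `A · X` and of `X · A`
are dense in `X`. -/
structure IsEssential (M : BanachBimodule A X) : Prop where
  left_dense : Dense (Submodule.span ℂ {y : X | ∃ (a : A) (x : X), y = M.left a x} : Set X)
  right_dense : Dense (Submodule.span ℂ {y : X | ∃ (a : A) (x : X), y = M.right a x} : Set X)

/-- The dual bimodule structure on `X*`: `(a · f)(x) = f (x · a)` and `(f · a)(x) = f (a · x)`. -/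
noncomputable def dual (M : BanachBimodule A X) : BanachBimodule A (StrongDual ℂ X) where
  left := (ContinuousLinearMap.compL ℂ X X ℂ).flip ∘L M.right
  right := (ContinuousLinearMap.compL ℂ X X ℂ).flip ∘L M.left
  left_mul a b f := by
    ext x
    simp [M.right_mul]
  right_mul a b f := by
    ext x
    simp [M.left_mul]
  left_right a b f := by
    ext x
    simp [M.left_right]

theorem dual_left_apply (M : BanachBimodule A X) (a : A) (f : StrongDual ℂ X) (x : X) :
    M.dual.left a f x = f (M.right a x) := rfl

theorem dual_right_apply (M : BanachBimodule A X) (a : A) (f : StrongDual ℂ X) (x : X) :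
    M.dual.right a f x = f (M.left a x) := rfl

/-- A linear map `D : A → X` is hyperlocal if `a b = b c = 0` implies `a · D b · c = 0`. -/
def IsHyperlocal (M : BanachBimodule A X) (D : A →ₗ[ℂ] X) : Prop :=
  ∀ a b c : A, a * b = 0 → b * c = 0 → M.right c (M.left a (D b)) = 0

/-- A linear map `D : A → X` is a derivation if `D (a b) = a · D b + D a · b`. -/
def IsDerivation (M : BanachBimodule A X) (D : A →ₗ[ℂ] X) : Prop :=
  ∀ a b : A, D (a * b) = M.left a (D b) + M.right b (D a)

/-- A linear map `T : A → X` is a right multiplier if `T (a b) = a · T b`. -/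
def IsRightMultiplier (M : BanachBimodule A X) (T : A →ₗ[ℂ] X) : Prop :=
  ∀ a b : A, T (a * b) = M.left a (T b)

end BanachBimodule

/-- A (two-sided) bounded approximate identity of `A`, given as a family `e` indexed by a
preordered set (a net when the index set is nonempty and directed). -/
structure IsBoundedApproximateIdentity {A : Type u} [NonUnitalNormedRing A]
    {Λ : Type w} [Preorder Λ] (e : Λ → A) : Prop where
  bounded : ∃ C : ℝ, ∀ i, ‖e i‖ ≤ C
  tendsto_left : ∀ a : A, Tendsto (fun i => e i * a) atTop (𝓝 a)
  tendsto_right : ∀ a : A, Tendsto (fun i => a * e i) atTop (𝓝 a)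

/-! The engine is that a bounded bilinear `φ` on a C⋆-algebra which vanishes on zero products is
balanced: `φ (ab) c = φ a (bc)`. For self-adjoint `b`, a tent partition of unity on the spectrum
gives `1 = ∑ Hᵢ` and `b = ∑ i Hᵢ` in the unitization, with `Hᵢ Hⱼ = 0` unless `|i - j| ≤ 1`. The
defect becomes `∑ (i - j) φ (a Hᵢ) (Hⱼ c)`, in which only neighbours survive. It is bounded
independently of `b`, yet linear in `b`, so it is zero (`apply_mul_eq_apply_mul`).

Using this twice on a hyperlocal `D`, and cancelling outer factors by essentiality, gives `D(azc) =
a D(zc) + D(az) c - a D(z) c` (`IsHyperlocal.map_mul_mul`). If `z` runs through an approximate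
identity with `D(z) → F` weak*, then `D(ac) = a D(c) + D(a) c - a F c`. Hence `T(a) = a F` is a
right multiplier and `D - T` a derivation; when `F = 0`, `D` itself is a derivation. -/

/-- The tent function of height one supported on `[-1, 1]`. -/
noncomputable def tent (t : ℝ) : ℝ := max 0 (1 - |t|)

theorem continuous_tent : Continuous tent := by
  unfold tent; fun_prop

theorem tent_nonneg (t : ℝ) : 0 ≤ tent t := le_max_left _ _

theorem tent_eq_zero {t : ℝ} (ht : 1 ≤ |t|) : tent t = 0 :=
  max_eq_left (by linarith)

theorem tent_sub_mul_tent_sub_eq_zero {i j : ℤ} (h : 1 < |i - j|) (t : ℝ) :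
    tent (t - i) * tent (t - j) = 0 := by
  by_cases hi : 1 ≤ |t - i|
  · rw [tent_eq_zero hi, zero_mul]
  · rw [tent_eq_zero (t := t - j), mul_zero]
    have h2 : (2 : ℝ) ≤ |(i : ℝ) - j| := by exact_mod_cast h
    have h3 := abs_sub_le (i : ℝ) t j
    rw [abs_sub_comm (i : ℝ) t] at h3
    linarith

/-- At `t` only the tents centred at `⌊t⌋` and `⌊t⌋ + 1` can be nonzero, so the sum interpolates `g`
linearly. Strictness of `|t| < N` keeps `⌊t⌋ + 1` in range. -/
theorem sum_mul_tent_sub {N : ℤ} {t : ℝ} (ht : |t| < N) (g : ℤ → ℝ) :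
    ∑ i ∈ Finset.Icc (-N) N, g i * tent (t - i) =
      g ⌊t⌋ * (1 - Int.fract t) + g (⌊t⌋ + 1) * Int.fract t := by
  obtain ⟨h1, h2⟩ := abs_lt.mp ht
  have hlo : -N ≤ ⌊t⌋ := Int.le_floor.mpr (by push_cast; linarith)
  have hhi : ⌊t⌋ < N := Int.floor_lt.mpr h2
  have h0 := Int.fract_nonneg t
  have h3 := Int.fract_lt_one t
  have hf : t = ⌊t⌋ + Int.fract t := (Int.floor_add_fract t).symm
  rw [← Finset.sum_subset (s₁ := {⌊t⌋, ⌊t⌋ + 1})]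
  · rw [Finset.sum_pair (by simp)]
    have e1 : tent (t - ⌊t⌋) = 1 - Int.fract t := by
      rw [Int.self_sub_floor, tent, abs_of_nonneg h0]
      exact max_eq_right (by linarith)
    have e2 : tent (t - (⌊t⌋ + 1 : ℤ)) = Int.fract t := by
      have : t - (⌊t⌋ + 1 : ℤ) = -(1 - Int.fract t) := by push_cast; linarith
      rw [this, tent, abs_neg, abs_of_nonneg (by linarith)]
      rw [max_eq_right (by linarith)]; ring
    rw [e1, e2]
  · intro i hi
    simp only [Finset.mem_insert, Finset.mem_singleton] at hi
    rw [Finset.mem_Icc]; omega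
  · intro i _ hi
    simp only [Finset.mem_insert, Finset.mem_singleton, not_or] at hi
    rw [tent_eq_zero, mul_zero]
    rcases (show i ≤ ⌊t⌋ - 1 ∨ ⌊t⌋ + 2 ≤ i by omega) with h | h
    · have : (i : ℝ) ≤ ⌊t⌋ - 1 := by exact_mod_cast h
      exact le_trans (by linarith) (le_abs_self _)
    · have : (⌊t⌋ : ℝ) + 2 ≤ i := by exact_mod_cast h
      exact le_trans (by linarith) (neg_le_abs _)

theorem sum_tent_sub {N : ℤ} {t : ℝ} (ht : |t| < N) :
    ∑ i ∈ Finset.Icc (-N) N, tent (t - i) = 1 := by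
  simpa using sum_mul_tent_sub ht (fun _ => 1)

theorem sum_intCast_mul_tent_sub {N : ℤ} {t : ℝ} (ht : |t| < N) :
    ∑ i ∈ Finset.Icc (-N) N, (i : ℝ) * tent (t - i) = t := by
  rw [sum_mul_tent_sub ht (fun i => (i : ℝ))]
  have := Int.floor_add_fract t
  push_cast
  linarith

/-! ### Almost diagonal bilinear maps and partitions of unity -/

/-- A bilinear map that is almost diagonal on a family `H` almost commutes with the diagonal
operator `H i ↦ i • H i`. -/
theorem norm_apply_sum_zsmul_sub_le {B Y : Type*} [SeminormedAddCommGroup B] [NormedSpace ℂ B]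
    [SeminormedAddCommGroup Y] [NormedSpace ℂ Y] (ψ : B →L[ℂ] B →L[ℂ] Y) (s : Finset ℤ) (H : ℤ → B)
    (h0 : ∀ i j : ℤ, 1 < |i - j| → ψ (H i) (H j) = 0)
    (h1 : ∀ r : ℤ, ‖∑ i ∈ s with i % 3 = r, H i‖ ≤ 1) :
    ‖ψ (∑ i ∈ s, i • H i) (∑ i ∈ s, H i) - ψ (∑ i ∈ s, H i) (∑ i ∈ s, i • H i)‖ ≤ 6 * ‖ψ‖ := by
  set P : ℤ → B := fun r => ∑ i ∈ s with i % 3 = r, H i with hP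
  -- Only `i - j ∈ {-1, 0, 1}` contributes, and there residues mod 3 determine `i - j`. Grouping by
  -- residue thus leaves three terms with coefficient `1` and three with `-1`, whatever the size of
  -- `s`.
  have key : ψ (∑ i ∈ s, i • H i) (∑ i ∈ s, H i) - ψ (∑ i ∈ s, H i) (∑ i ∈ s, i • H i) =
      (ψ (P 1) (P 0) + ψ (P 2) (P 1) + ψ (P 0) (P 2)) -
        (ψ (P 0) (P 1) + ψ (P 1) (P 2) + ψ (P 2) (P 0)) := by
    have hPP : ∀ r q : ℤ, ψ (P r) (P q) =
        ∑ i ∈ s, ∑ j ∈ s, if i % 3 = r ∧ j % 3 = q then ψ (H i) (H j) else 0 := by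
      intro r q
      simp only [hP, map_sum, sum_apply, Finset.sum_filter]
      rw [Finset.sum_comm]
      refine Finset.sum_congr rfl fun i _ => ?_
      by_cases hi : i % 3 = r
      · simp [hi, apply_ite]
      · simp [hi]
    have hL : ψ (∑ i ∈ s, i • H i) (∑ i ∈ s, H i) = ∑ i ∈ s, ∑ j ∈ s, i • ψ (H i) (H j) := by
      simp only [map_sum, sum_apply, map_zsmul, smul_apply]
      exact Finset.sum_comm
    have hR : ψ (∑ i ∈ s, H i) (∑ i ∈ s, i • H i) = ∑ i ∈ s, ∑ j ∈ s, j • ψ (H i) (H j) := by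
      simp only [map_sum, sum_apply, map_zsmul, Finset.smul_sum]
      exact Finset.sum_comm
    simp only [hPP, hL, hR, ← Finset.sum_add_distrib, ← Finset.sum_sub_distrib]
    refine Finset.sum_congr rfl fun i _ => Finset.sum_congr rfl fun j _ => ?_
    rw [← sub_smul]
    by_cases hij : 1 < |i - j|
    · simp [h0 i j hij]
    · obtain ⟨hl, hr⟩ := abs_le.mp (not_lt.mp hij)
      generalize ψ (H i) (H j) = z
      have hi : i % 3 = 0 ∨ i % 3 = 1 ∨ i % 3 = 2 := by omega
      rcases (show i - j = -1 ∨ i - j = 0 ∨ i - j = 1 by omega) with h | h | h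
      · rcases hi with hi | hi | hi
        · simp [h, hi, show j % 3 = 1 by omega]
        · simp [h, hi, show j % 3 = 2 by omega]
        · simp [h, hi, show j % 3 = 0 by omega]
      · rcases hi with hi | hi | hi <;> simp [h, hi, show j % 3 = i % 3 by omega]
      · rcases hi with hi | hi | hi
        · simp [h, hi, show j % 3 = 2 by omega]
        · simp [h, hi, show j % 3 = 0 by omega]
        · simp [h, hi, show j % 3 = 1 by omega]
  have hb : ∀ r q : ℤ, ‖ψ (P r) (P q)‖ ≤ ‖ψ‖ := fun r q => by
    refine (ψ.le_opNorm₂ _ _).trans ?_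
    calc ‖ψ‖ * ‖P r‖ * ‖P q‖ ≤ ‖ψ‖ * 1 * 1 := by gcongr <;> apply h1
      _ = ‖ψ‖ := by ring
  rw [key]
  refine (norm_sub_le _ _).trans ?_
  have n1 := norm_add₃_le (a := ψ (P 1) (P 0)) (b := ψ (P 2) (P 1)) (c := ψ (P 0) (P 2))
  have n2 := norm_add₃_le (a := ψ (P 0) (P 1)) (b := ψ (P 1) (P 2)) (c := ψ (P 2) (P 0))
  linarith [hb 1 0, hb 2 1, hb 0 2, hb 0 1, hb 1 2, hb 2 0]

/-- A self-adjoint element of a unital C⋆-algebra is the sum `∑ i • H i` for a finite partition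
of unity `H` obtained from the tent functions. -/
theorem IsSelfAdjoint.exists_tent_partition {B : Type*} [CStarAlgebra B] {b : B}
    (hb : IsSelfAdjoint b) :
    ∃ (s : Finset ℤ) (H : ℤ → B), ∑ i ∈ s, H i = 1 ∧ ∑ i ∈ s, i • H i = b ∧
      (∀ i j : ℤ, 1 < |i - j| → H i * H j = 0) ∧
      ∀ r : ℤ, ‖∑ i ∈ s with i % 3 = r, H i‖ ≤ 1 := by
  have hc : ∀ i : ℤ, Continuous fun t : ℝ => tent (t - i) :=
    fun i => continuous_tent.comp (continuous_id.sub continuous_const)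
  have hc' : ∀ i : ℤ, ContinuousOn (fun t : ℝ => tent (t - i)) (spectrum ℝ b) :=
    fun i => (hc i).continuousOn
  obtain ⟨N, hN⟩ := exists_int_gt (‖b‖ * ‖(1 : B)‖)
  have hσ : ∀ t ∈ spectrum ℝ b, |t| < N := fun t ht =>
    lt_of_le_of_lt (spectrum.norm_le_norm_mul_of_mem ht) hN
  refine ⟨Finset.Icc (-N) N, fun i => cfc (fun t : ℝ => tent (t - i)) b, ?_, ?_, ?_, ?_⟩
  · rw [← cfc_sum _ _ _ (fun i _ => hc' i), ← cfc_one ℝ b]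
    refine cfc_congr fun t ht => ?_
    simpa using sum_tent_sub (hσ t ht)
  · have : ∀ i : ℤ, i • cfc (fun t : ℝ => tent (t - i)) b =
        cfc (fun t : ℝ => (i : ℝ) * tent (t - i)) b := fun i => by
      rw [cfc_const_mul _ _ _ (hc' i), Int.cast_smul_eq_zsmul]
    simp only [this]
    rw [← cfc_sum (fun (i : ℤ) (t : ℝ) => (i : ℝ) * tent (t - i)) _ _
      (fun i _ => (continuous_const.mul (hc i)).continuousOn)]
    conv_rhs => rw [← cfc_id ℝ b]
    refine cfc_congr fun t ht => ?_
    simpa using sum_intCast_mul_tent_sub (hσ t ht)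
  · intro i j hij
    rw [← cfc_mul _ _ _ (hc' i) (hc' j)]
    simp only [tent_sub_mul_tent_sub_eq_zero hij]
    exact cfc_const_zero ℝ b
  · intro r
    rw [← cfc_sum _ _ _ (fun i _ => hc' i)]
    -- A partial sum of nonnegative tents lies between 0 and the full sum 1.
    refine norm_cfc_le zero_le_one fun t ht => ?_
    rw [Finset.sum_apply, Real.norm_of_nonneg (Finset.sum_nonneg fun i _ => tent_nonneg _),
      ← sum_tent_sub (hσ t ht)]
    exact Finset.sum_le_sum_of_subset_of_nonneg (Finset.filter_subset _ _)
      fun i _ _ => tent_nonneg _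

/-! ### Bilinear maps vanishing on zero products -/

section ZeroProducts

variable {A : Type*} [NonUnitalCStarAlgebra A]

/-- The product `a * F` of `a : A` and an element `F` of the unitization, as an element of `A`. -/
noncomputable def mulUnitization (a : A) : Unitization ℂ A →ₗ[ℂ] A where
  toFun F := ((a : Unitization ℂ A) * F).snd
  map_add' F G := by rw [mul_add, Unitization.snd_add]
  map_smul' c F := by rw [mul_smul_comm, Unitization.snd_smul, RingHom.id_apply]

/-- The product `F * a` of `a : A` and an element `F` of the unitization, as an element of `A`. -/
noncomputable def unitizationMul (a : A) : Unitization ℂ A →ₗ[ℂ] A where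
  toFun F := (F * (a : Unitization ℂ A)).snd
  map_add' F G := by rw [add_mul, Unitization.snd_add]
  map_smul' c F := by rw [smul_mul_assoc, Unitization.snd_smul, RingHom.id_apply]

theorem coe_mulUnitization (a : A) (F : Unitization ℂ A) :
    (mulUnitization a F : Unitization ℂ A) = a * F := by
  ext <;> simp [mulUnitization]

theorem coe_unitizationMul (a : A) (F : Unitization ℂ A) :
    (unitizationMul a F : Unitization ℂ A) = F * a := by
  ext <;> simp [unitizationMul]

theorem norm_mulUnitization_le (a : A) (F : Unitization ℂ A) :
    ‖mulUnitization a F‖ ≤ ‖a‖ * ‖F‖ := by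
  rw [← Unitization.norm_inr (𝕜 := ℂ), coe_mulUnitization, ← Unitization.norm_inr (𝕜 := ℂ) a]
  exact norm_mul_le _ _

theorem norm_unitizationMul_le (a : A) (F : Unitization ℂ A) :
    ‖unitizationMul a F‖ ≤ ‖a‖ * ‖F‖ := by
  rw [← Unitization.norm_inr (𝕜 := ℂ), coe_unitizationMul, ← Unitization.norm_inr (𝕜 := ℂ) a,
    mul_comm ‖_‖]
  exact norm_mul_le _ _

theorem mulUnitization_mul_unitizationMul (a c : A) {F G : Unitization ℂ A} (h : F * G = 0) :
    mulUnitization a F * unitizationMul c G = 0 := by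
  apply Unitization.inr_injective (R := ℂ)
  rw [Unitization.inr_mul, coe_mulUnitization, coe_unitizationMul, mul_assoc, ← mul_assoc F, h]
  simp

variable {Y : Type*} [NormedAddCommGroup Y] [NormedSpace ℂ Y] (φ : A →L[ℂ] A →L[ℂ] Y)

theorem norm_apply_mul_sub_le_of_isSelfAdjoint (hφ : ∀ a b : A, a * b = 0 → φ a b = 0)
    (a c : A) {b : A} (hb : IsSelfAdjoint b) :
    ‖φ (a * b) c - φ a (b * c)‖ ≤ 6 * (‖φ‖ * ‖a‖ * ‖c‖) := by
  obtain ⟨s, H, h1, h2, h3, h4⟩ := (hb.inr ℂ).exists_tent_partition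
  -- The partition lives in the unitization; multiplying by `a` and `c` brings it back into `A`,
  -- where `φ` is defined.
  let L := (mulUnitization a).mkContinuous ‖a‖ (norm_mulUnitization_le a)
  let R := (unitizationMul c).mkContinuous ‖c‖ (norm_unitizationMul_le c)
  have hψ : ‖φ.bilinearComp L R‖ ≤ ‖φ‖ * ‖a‖ * ‖c‖ := by
    refine ContinuousLinearMap.opNorm_le_bound₂ _ (by positivity) fun F G => ?_
    calc ‖φ (L F) (R G)‖ ≤ ‖φ‖ * ‖L F‖ * ‖R G‖ := φ.le_opNorm₂ _ _
      _ ≤ ‖φ‖ * (‖a‖ * ‖F‖) * (‖c‖ * ‖G‖) := by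
        gcongr
        · exact norm_mulUnitization_le a F
        · exact norm_unitizationMul_le c G
      _ = _ := by ring
  have key := norm_apply_sum_zsmul_sub_le (φ.bilinearComp L R) s H
    (fun i j hij => hφ _ _ (mulUnitization_mul_unitizationMul a c (h3 i j hij))) h4
  rw [h1, h2] at key
  have e1 : L b = a * b := by simp [L, mulUnitization]
  have e2 : R b = b * c := by simp [R, unitizationMul]
  have e3 : L 1 = a := by simp [L, mulUnitization]
  have e4 : R 1 = c := by simp [R, unitizationMul]
  simp only [ContinuousLinearMap.bilinearComp_apply, e1, e2, e3, e4] at key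
  linarith

theorem apply_mul_eq_of_isSelfAdjoint (hφ : ∀ a b : A, a * b = 0 → φ a b = 0)
    (a c : A) {b : A} (hb : IsSelfAdjoint b) : φ (a * b) c = φ a (b * c) := by
  rw [← sub_eq_zero, ← norm_eq_zero]
  by_contra hne
  have hpos : 0 < ‖φ (a * b) c - φ a (b * c)‖ := lt_of_le_of_ne (norm_nonneg _) (Ne.symm hne)
  obtain ⟨n, hn⟩ := exists_nat_gt (6 * (‖φ‖ * ‖a‖ * ‖c‖) / ‖φ (a * b) c - φ a (b * c)‖)
  rw [div_lt_iff₀ hpos] at hn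
  -- The bound does not depend on `b`, while the left side scales by `n` when `b` becomes `n • b`.
  have h := norm_apply_mul_sub_le_of_isSelfAdjoint φ hφ a c (b := n • b)
    (by rw [isSelfAdjoint_iff, star_nsmul, hb.star_eq])
  rw [mul_smul_comm, smul_mul_assoc, map_nsmul, map_nsmul, smul_apply, ← nsmul_sub, ← Nat.cast_smul_eq_nsmul ℝ,
    norm_smul, Real.norm_natCast] at h
  linarith

/-- A bounded bilinear map on a C⋆-algebra that vanishes on zero products is balanced. -/
theorem apply_mul_eq_apply_mul (hφ : ∀ a b : A, a * b = 0 → φ a b = 0) (a b c : A) :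
    φ (a * b) c = φ a (b * c) := by
  have h1 := apply_mul_eq_of_isSelfAdjoint φ hφ a c (realPart b).2
  have h2 := apply_mul_eq_of_isSelfAdjoint φ hφ a c (imaginaryPart b).2
  rw [← realPart_add_I_smul_imaginaryPart b]
  simp only [mul_add, add_mul, mul_smul_comm, smul_mul_assoc, map_add, map_smul, add_apply,
    smul_apply, h1, h2]

end ZeroProducts

namespace BanachBimodule

/-! ### Faithfulness of the dual actions, and the easy implication -/

section Faithful

variable {A X : Type*} [NonUnitalNormedRing A] [NormedSpace ℂ A] [NormedAddCommGroup X]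
  [NormedSpace ℂ X] {M : BanachBimodule A X}

theorem IsEssential.eq_zero_of_dual_left (hM : M.IsEssential) {f : StrongDual ℂ X}
    (hf : ∀ a, M.dual.left a f = 0) : f = 0 := by
  refine ContinuousLinearMap.ext_on hM.right_dense ?_
  rintro _ ⟨a, x, rfl⟩
  exact DFunLike.congr_fun (hf a) x

theorem IsEssential.eq_zero_of_dual_right (hM : M.IsEssential) {f : StrongDual ℂ X}
    (hf : ∀ a, M.dual.right a f = 0) : f = 0 := by
  refine ContinuousLinearMap.ext_on hM.left_dense ?_
  rintro _ ⟨a, x, rfl⟩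
  exact DFunLike.congr_fun (hf a) x

theorem IsEssential.eq_zero_of_dual (hM : M.IsEssential) {f : StrongDual ℂ X}
    (hf : ∀ a c, M.dual.right c (M.dual.left a f) = 0) : f = 0 :=
  hM.eq_zero_of_dual_left fun a => hM.eq_zero_of_dual_right (hf a)

/-- Multiply `0 = 𝒟(bc) = b 𝒟(c) + 𝒟(b) c` on the left by `a`; the first term dies because `ab = 0`.
-/
theorem IsDerivation.add_isRightMultiplier_isHyperlocal {𝒟 T : A →ₗ[ℂ] X}
    (h𝒟 : M.IsDerivation 𝒟) (hT : M.IsRightMultiplier T) : M.IsHyperlocal (𝒟 + T) := by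
  intro a b c hab hbc
  have h1 : M.left a (T b) = 0 := by rw [← hT, hab, map_zero]
  have h2 : M.right c (M.left a (𝒟 b)) = 0 := by
    have := congrArg (M.left a) (h𝒟 b c)
    rwa [hbc, map_zero, map_zero, map_add, ← M.left_mul, hab, map_zero, zero_apply, zero_add,
      M.left_right, eq_comm] at this
  rw [LinearMap.add_apply, map_add, map_add, h2, h1, map_zero, add_zero]

end Faithful

/-! ### Approximate identities and the cocycle identity -/

section CStar

variable {A : Type*} [NonUnitalCStarAlgebra A]

theorem exists_contractive_approximateIdentity_filter :
    ∃ l : Filter A, l.NeBot ∧ (∀ᶠ x in l, ‖x‖ ≤ 1) ∧ (∀ a, Tendsto (· * a) l (𝓝 a)) ∧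
      ∀ a, Tendsto (a * ·) l (𝓝 a) := by
  let _ : PartialOrder A := CStarAlgebra.spectralOrder A
  have _ : StarOrderedRing A := CStarAlgebra.spectralOrderedRing A
  have h := CStarAlgebra.increasingApproximateUnit A
  exact ⟨_, h.neBot, h.eventually_norm, h.tendsto_mul_right, h.tendsto_mul_left⟩

/-- The positive elements of the open unit ball are directed, so they form a net indexed by
themselves that refines the approximate unit filter. -/
theorem exists_isBoundedApproximateIdentity (A : Type u) [NonUnitalCStarAlgebra A] :
    ∃ (Λ : Type u) (_ : Preorder Λ) (_ : IsDirectedOrder Λ) (_ : Nonempty Λ) (e : Λ → A),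
      IsBoundedApproximateIdentity e := by
  let _ : PartialOrder A := CStarAlgebra.spectralOrder A
  have _ : StarOrderedRing A := CStarAlgebra.spectralOrderedRing A
  let s : Set A := {x : A | 0 ≤ x} ∩ Metric.ball 0 1
  have hdir : DirectedOn (· ≤ ·) s := CStarAlgebra.directedOn_nonneg_ball
  have hd : IsDirectedOrder s := directedOn_iff_isDirectedOrder.mp hdir
  have hne : Nonempty s := ⟨⟨0, by simp [s]⟩⟩
  have h := CStarAlgebra.increasingApproximateUnit A
  have ht : Tendsto (Subtype.val : s → A) atTop (CStarAlgebra.approximateUnit A) := by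
    rw [(CStarAlgebra.hasBasis_approximateUnit A).tendsto_right_iff]
    intro x hx
    filter_upwards [eventually_ge_atTop (⟨x, by simpa [s] using hx⟩ : s)] with y hy
    refine ⟨hy, ?_⟩
    exact Metric.ball_subset_closedBall y.2.2
  refine ⟨s, inferInstance, hd, hne, Subtype.val, ⟨1, fun i => ?_⟩, fun a => ?_, fun a => ?_⟩
  · exact (mem_ball_zero_iff.mp i.2.2).le
  · exact (h.tendsto_mul_right a).comp ht
  · exact (h.tendsto_mul_left a).comp ht

variable {Y : Type*} [NormedAddCommGroup Y] [NormedSpace ℂ Y] {N : BanachBimodule A Y}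
  {D : A →L[ℂ] Y}

/-- A bounded hyperlocal map into a faithful bimodule satisfies the cocycle-type identity that
characterizes sums of derivations and right multipliers. -/
theorem IsHyperlocal.map_mul_mul (hN : ∀ y : Y, (∀ a c, N.right c (N.left a y) = 0) → y = 0)
    (hD : N.IsHyperlocal D.toLinearMap) (a z c : A) :
    D (a * z * c) = N.left a (D (z * c)) + N.right c (D (a * z)) - N.left a (N.right c (D z)) := by
  -- For fixed `bc = 0`, hyperlocality makes `(x, y) ↦ x D(yb) c` vanish on zero products.
  have step1 : ∀ a d' d b c : A, b * c = 0 →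
      N.right c (N.left a (N.left d' (D (d * b)) - D (d' * d * b))) = 0 := by
    intro a d' d b c hbc
    have := apply_mul_eq_apply_mul
      ((ContinuousLinearMap.compL ℂ A Y Y (N.right c)) ∘L
        N.left.bilinearComp (.id ℂ A) (D ∘L (ContinuousLinearMap.mul ℂ A).flip b))
      (fun x y hxy => hD x (y * b) c (by rw [← mul_assoc, hxy, zero_mul])
        (by rw [mul_assoc, hbc, mul_zero])) a d' d
    change N.right c (N.left (a * d') (D (d * b))) = N.right c (N.left a (D (d' * d * b))) at this
    rw [map_sub, map_sub, ← this, N.left_mul, sub_self]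
  -- By `step1`, `(x, y) ↦ a (d' D(dx) - D(d'dx)) y` vanishes on zero products, hence is balanced;
  -- faithfulness then removes the outer factors.
  have step2 : ∀ d' d b e : A, N.left d' (D (d * (b * e))) - D (d' * d * (b * e)) =
      N.right e (N.left d' (D (d * b)) - D (d' * d * b)) := by
    intro d' d b e
    rw [← sub_eq_zero]
    refine hN _ fun a c => ?_
    have := apply_mul_eq_apply_mul
      (N.right.flip ∘L N.left a ∘L (N.left d' ∘L D ∘L ContinuousLinearMap.mul ℂ A d -
        D ∘L ContinuousLinearMap.mul ℂ A (d' * d)))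
      (fun x y hxy => step1 a d' d x y hxy) b e c
    change N.right c (N.left a (N.left d' (D (d * (b * e))) - D (d' * d * (b * e)))) =
      N.right (e * c) (N.left a (N.left d' (D (d * b)) - D (d' * d * b))) at this
    rw [map_sub, map_sub, this, N.right_mul, N.left_right, sub_self]
  -- `step2` is the claim for `dz` in place of `z`; let `d` run through an approximate identity.
  obtain ⟨l, hl, -, hl1, -⟩ := exists_contractive_approximateIdentity_filter (A := A)
  have hlim := hl1 z
  have hcl : IsClosed {z : A | D (a * z * c) =
      N.left a (D (z * c)) + N.right c (D (a * z)) - N.left a (N.right c (D z))} :=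
    isClosed_eq (by fun_prop) (by fun_prop)
  refine hcl.mem_of_tendsto hlim (Eventually.of_forall fun d => ?_)
  have := step2 a d z c
  simp only [map_sub] at this
  simp only [Set.mem_ofPred_eq, mul_assoc] at this ⊢
  rw [N.left_right, ← sub_eq_zero]
  rw [← sub_eq_zero] at this
  rw [← neg_eq_zero, ← this]
  abel

end CStar

/-! ### Weak* limits along approximate identities -/

section Dual

variable {A : Type u} [NonUnitalCStarAlgebra A] {X : Type v} [NormedAddCommGroup X]
  [NormedSpace ℂ X] {M : BanachBimodule A X} {D : A →L[ℂ] StrongDual ℂ X}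

/-- Passing to the limit along an approximate identity `e` in `IsHyperlocal.map_mul_mul`. -/
theorem IsHyperlocal.map_mul_of_tendsto (hM : M.IsEssential)
    (hD : M.dual.IsHyperlocal D.toLinearMap) {ι : Type*} {l : Filter ι} [l.NeBot] {e : ι → A}
    (he : ∀ a, Tendsto (fun i => a * e i) l (𝓝 a)) (he' : ∀ a, Tendsto (fun i => e i * a) l (𝓝 a))
    {F : StrongDual ℂ X} (hF : ∀ x, Tendsto (fun i => D (e i) x) l (𝓝 (F x))) (a c : A) :
    D (a * c) = M.dual.left a (D c) + M.dual.right c (D a) -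
      M.dual.left a (M.dual.right c F) := by
  ext x
  have h1 : Tendsto (fun i => D (a * e i * c) x) l (𝓝 (D (a * c) x)) := by
    have : Continuous fun b => D (b * c) x := by fun_prop
    exact (this.tendsto a).comp (he a)
  have h2 : Tendsto (fun i => M.dual.left a (D (e i * c)) x) l (𝓝 (M.dual.left a (D c) x)) := by
    have : Continuous fun b => D b (M.right a x) := by fun_prop
    exact (this.tendsto c).comp (he' c)
  have h3 : Tendsto (fun i => M.dual.right c (D (a * e i)) x) l
      (𝓝 (M.dual.right c (D a) x)) := by
    have : Continuous fun b => D b (M.left c x) := by fun_prop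
    exact (this.tendsto a).comp (he a)
  have h4 : Tendsto (fun i => M.dual.left a (M.dual.right c (D (e i))) x) l
      (𝓝 (M.dual.left a (M.dual.right c F) x)) := hF _
  refine tendsto_nhds_unique h1 (((h2.add h3).sub h4).congr fun i => ?_)
  rw [hD.map_mul_mul (fun y => hM.eq_zero_of_dual) a (e i) c]
  rfl

/-- Banach–Alaoglu; an ultrafilter plays the role of a convergent subnet. -/
theorem exists_tendsto_of_bounded (D : A →L[ℂ] StrongDual ℂ X) {l : Filter A} [l.NeBot]
    (hl : ∀ᶠ x in l, ‖x‖ ≤ 1) :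
    ∃ (U : Ultrafilter A) (F : StrongDual ℂ X), (U : Filter A) ≤ l ∧
      ∀ x, Tendsto (fun a => D a x) U (𝓝 (F x)) := by
  let U := Ultrafilter.of l
  have hU : (U : Filter A) ≤ l := Ultrafilter.of_le l
  have hK := WeakDual.isCompact_closedBall (𝕜 := ℂ) (E := X) 0 ‖D‖
  have hmem : ∀ᶠ a in (U : Filter A), StrongDual.toWeakDual (D a) ∈
      WeakDual.toStrongDual ⁻¹' Metric.closedBall (0 : StrongDual ℂ X) ‖D‖ := by
    filter_upwards [hU hl] with a ha
    refine mem_closedBall_zero_iff.mpr ?_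
    exact (D.le_opNorm a).trans (mul_le_of_le_one_right (norm_nonneg _) ha)
  obtain ⟨F, -, hF⟩ := hK.ultrafilter_le_nhds (U.map fun a => StrongDual.toWeakDual (D a))
    (le_principal_iff.mpr hmem)
  refine ⟨U, WeakDual.toStrongDual F, hU, fun x => ?_⟩
  exact ((WeakDual.eval_continuous x).tendsto F).comp hF

theorem IsHyperlocal.exists_isDerivation_add_isRightMultiplier (hM : M.IsEssential)
    (hD : M.dual.IsHyperlocal D.toLinearMap) :
    ∃ 𝒟 T : A →L[ℂ] StrongDual ℂ X, M.dual.IsDerivation 𝒟.toLinearMap ∧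
      M.dual.IsRightMultiplier T.toLinearMap ∧ D = 𝒟 + T := by
  obtain ⟨l, hl, hl1, hl2, hl3⟩ := exists_contractive_approximateIdentity_filter (A := A)
  obtain ⟨U, F, hU, hF⟩ := exists_tendsto_of_bounded D hl1
  have h := hD.map_mul_of_tendsto hM (e := id) (fun a => (hl3 a).mono_left hU)
    (fun a => (hl2 a).mono_left hU) hF
  refine ⟨D - M.dual.left.flip F, M.dual.left.flip F, fun a b => ?_, fun a b => ?_,
    by ext a x; exact (sub_add_cancel (D a x) _).symm⟩
  · change D (a * b) - M.dual.left (a * b) F = M.dual.left a (D b - M.dual.left b F) +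
      M.dual.right b (D a - M.dual.left a F)
    rw [h, map_sub, map_sub, M.dual.left_mul, M.dual.left_right]
    abel
  · exact M.dual.left_mul a b F

theorem tendsto_toWeakDual_zero_iff {ι : Type*} {l : Filter ι} {f : ι → StrongDual ℂ X} :
    Tendsto (fun i => StrongDual.toWeakDual (f i)) l (𝓝 0) ↔
      ∀ x, Tendsto (fun i => f i x) l (𝓝 0) :=
  tendsto_iff_forall_eval_tendsto_topDualPairing

/-- A bounded family of operators converges pointwise if it does so on a set with dense span. -/
theorem tendsto_apply_of_dense_span {E Z : Type*} [NormedAddCommGroup E] [NormedSpace ℂ E]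
    [NormedAddCommGroup Z] [NormedSpace ℂ Z] {ι : Type*} {l : Filter ι} {f : ι → E →L[ℂ] Z}
    {g : E →L[ℂ] Z} {C : ℝ} (hC : ∀ i, ‖f i‖ ≤ C) {s : Set E}
    (hs : Dense (Submodule.span ℂ s : Set E))
    (h : ∀ x ∈ s, Tendsto (fun i => f i x) l (𝓝 (g x))) (x : E) :
    Tendsto (fun i => f i x) l (𝓝 (g x)) := by
  have hbd : ∃ C, ∀ i, ‖f i‖ ≤ C := ⟨C, hC⟩
  -- A uniform norm bound gives equicontinuity, which makes the set of points of convergence closed.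
  have heq : Equicontinuous fun i x => f i x :=
    ((NormedSpace.equicontinuous_TFAE f).out 5 1 rfl rfl).mp hbd
  have hcl := heq.isClosed_setOfPred_tendsto (l := l) g.continuous
  refine hcl.closure_subset_iff.mpr (fun y hy => ?_) (hs x)
  induction hy using Submodule.span_induction with
  | mem y hy => exact h y hy
  | zero => simpa using tendsto_const_nhds
  | add y z _ _ hy hz => simpa using hy.add hz
  | smul c y _ hy => simpa using hy.const_smul c

/-- On `ya` the derivation rule gives `D(eᵢ)(ya) = D(a eᵢ)(y) - D(a)(eᵢ y)`, and both terms tend to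
`D(a)(y)`. Such vectors span a dense subspace, and `D(eᵢ)` is bounded. -/
theorem IsDerivation.tendsto_approximateIdentity (hM : M.IsEssential)
    (hD : M.dual.IsDerivation D.toLinearMap) {Λ : Type*} [Preorder Λ] {e : Λ → A}
    (he : IsBoundedApproximateIdentity e) :
    Tendsto (fun i => StrongDual.toWeakDual (D (e i))) atTop (𝓝 0) := by
  obtain ⟨C, hC⟩ := he.bounded
  rw [tendsto_toWeakDual_zero_iff]
  have hleft : ∀ y, Tendsto (fun i => M.left (e i) y) atTop (𝓝 y) := by
    refine tendsto_apply_of_dense_span (g := .id ℂ X) (C := ‖M.left‖ * C) (fun i => ?_)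
      hM.left_dense ?_
    · exact (M.left.le_opNorm _).trans (by gcongr; exact hC i)
    · rintro _ ⟨a, x, rfl⟩
      have : Continuous fun b => M.left b x := by fun_prop
      refine ((this.tendsto a).comp (he.tendsto_left a)).congr fun i => ?_
      exact M.left_mul (e i) a x
  refine tendsto_apply_of_dense_span (g := 0) (C := ‖D‖ * C) (fun i => ?_) hM.right_dense ?_
  · exact (D.le_opNorm _).trans (by gcongr; exact hC i)
  · rintro _ ⟨a, y, rfl⟩
    have h1 : Tendsto (fun i => D (a * e i) y) atTop (𝓝 (D a y)) := by
      have : Continuous fun b => D b y := by fun_prop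
      exact (this.tendsto a).comp (he.tendsto_right a)
    have h2 : Tendsto (fun i => D a (M.left (e i) y)) atTop (𝓝 (D a y)) :=
      ((D a).continuous.tendsto y).comp (hleft y)
    have h3 := h1.sub h2
    rw [sub_self] at h3
    refine h3.congr fun i => ?_
    have := DFunLike.congr_fun (hD a (e i)) y
    change D (a * e i) y = D (e i) (M.right a y) + D a (M.left (e i) y) at this
    rw [this, add_sub_cancel_right]

theorem IsHyperlocal.isDerivation_of_tendsto_approximateIdentity (hM : M.IsEssential)
    (hD : M.dual.IsHyperlocal D.toLinearMap) {Λ : Type*} [Preorder Λ] [IsDirectedOrder Λ]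
    [Nonempty Λ] {e : Λ → A} (he : IsBoundedApproximateIdentity e)
    (h : Tendsto (fun i => StrongDual.toWeakDual (D (e i))) atTop (𝓝 0)) :
    M.dual.IsDerivation D.toLinearMap := by
  intro a c
  have := hD.map_mul_of_tendsto hM he.tendsto_right he.tendsto_left (F := 0)
    (tendsto_toWeakDual_zero_iff.mp h) a c
  rwa [map_zero, map_zero, sub_zero] at this

end Dual

end BanachBimodule

theorem theoremT {A : Type u} [NonUnitalCStarAlgebra A]
    {X : Type v} [NormedAddCommGroup X] [NormedSpace ℂ X] [CompleteSpace X]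
    (M : BanachBimodule A X) (hM : M.IsEssential) (D : A →L[ℂ] StrongDual ℂ X) :
    -- `D` is hyperlocal iff it is a derivation plus a right multiplier
    (M.dual.IsHyperlocal D.toLinearMap ↔
      ∃ 𝒟 T : A →ₗ[ℂ] StrongDual ℂ X,
        M.dual.IsDerivation 𝒟 ∧ M.dual.IsRightMultiplier T ∧ D.toLinearMap = 𝒟 + T) ∧
    -- and the two summands can then be taken bounded
    (M.dual.IsHyperlocal D.toLinearMap ↔
      ∃ 𝒟 T : A →L[ℂ] StrongDual ℂ X,
        M.dual.IsDerivation 𝒟.toLinearMap ∧ M.dual.IsRightMultiplier T.toLinearMap ∧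
          D = 𝒟 + T) ∧
    -- a hyperlocal `D` is a derivation iff `D (e i) → 0` weak*, for any and for some
    -- bounded approximate identity `e`
    (M.dual.IsHyperlocal D.toLinearMap →
      (∀ (Λ : Type w) [Preorder Λ] [IsDirectedOrder Λ] [Nonempty Λ] (e : Λ → A),
        IsBoundedApproximateIdentity e →
          (M.dual.IsDerivation D.toLinearMap ↔
            Tendsto (fun i => StrongDual.toWeakDual (D (e i))) atTop (𝓝 0))) ∧
      (M.dual.IsDerivation D.toLinearMap ↔
        ∃ (Λ : Type u) (_ : Preorder Λ) (_ : IsDirectedOrder Λ) (_ : Nonempty Λ) (e : Λ → A),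
          IsBoundedApproximateIdentity e ∧
            Tendsto (fun i => StrongDual.toWeakDual (D (e i))) atTop (𝓝 0))) := by
  have hconv : ∀ 𝒟 T : A →ₗ[ℂ] StrongDual ℂ X, M.dual.IsDerivation 𝒟 →
      M.dual.IsRightMultiplier T → D.toLinearMap = 𝒟 + T → M.dual.IsHyperlocal D.toLinearMap :=
    fun 𝒟 T h𝒟 hT h => h ▸ h𝒟.add_isRightMultiplier_isHyperlocal hT
  refine ⟨⟨fun hD => ?_, fun ⟨𝒟, T, h𝒟, hT, h⟩ => hconv 𝒟 T h𝒟 hT h⟩,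
    ⟨fun hD => hD.exists_isDerivation_add_isRightMultiplier hM,
      fun ⟨𝒟, T, h𝒟, hT, h⟩ => hconv _ _ h𝒟 hT (by rw [h]; rfl)⟩, fun hD => ⟨?_, ?_, ?_⟩⟩
  · obtain ⟨𝒟, T, h𝒟, hT, h⟩ := hD.exists_isDerivation_add_isRightMultiplier hM
    exact ⟨𝒟.toLinearMap, T.toLinearMap, h𝒟, hT, by rw [h]; rfl⟩
  · intro Λ _ _ _ e he
    exact ⟨fun h => h.tendsto_approximateIdentity hM he,
      hD.isDerivation_of_tendsto_approximateIdentity hM he⟩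
  · intro h
    obtain ⟨Λ, i1, i2, i3, e, he⟩ := BanachBimodule.exists_isBoundedApproximateIdentity A
    exact ⟨Λ, i1, i2, i3, e, he, h.tendsto_approximateIdentity hM he⟩
  · rintro ⟨Λ, i1, i2, i3, e, he, h⟩
    exact hD.isDerivation_of_tendsto_approximateIdentity hM he h
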